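/- Let $d\in\mathbb N$, let $\mathbb R^d$ carry the Euclidean metric, let $\mu$ be a Borel probability measure on $\mathbb R^d\times\{0,1\}$, and let $\varepsilon>0$. For a Borel set $A\subseteq\mathbb R^d$ with indicator function $1_A$, define the adversarial risk $$\widetilde R_\varepsilon(A)=\int \sup_{\tilde x\in B_\varepsilon(x)}|1_A(\tilde x)-y|\,\mathrm d\mu(x,y),$$ where $B_\varepsilon(x)$ is the open ball of radius $\varepsilon$ around $x$. A minimizer is a Borel set that minimizes $\widetilde R_\varepsilon$ among all Borel sets. There exists a minimizer $B$ whose boundary is locally the graph of a $C^{1,1/3}$ function. That is, for every $x\in\partial B$ there are a unit vector $n$, an open neighbourhood $U$ of $x$, and a continuously differentiable function $g$ with $1/3$-Hölder continuous derivative on an open subset $V$ of the hyperplane $n^\perp$, such that the orthogonal projection of $U$ to $n^\perp$ lies in $V$, the set $\partial B\cap U$ consists of those points of $U$ that lie on the graph $\{z+g(z)n : z\in V\}$, and $B$ lies on one side of this graph: every point $z+tn\in U$ with $z\in n^\perp$ belongs to $B$ if $t<g(z)$, and does not belong to $B$ if $t>g(z)$. Moreover, for every minimizer $A$ there is a minimizer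 $B$ whose boundary has this regularity and that satisfies $\mathrm{op}_\varepsilon(A)\subseteq B\subseteq \mathrm{cl}_\varepsilon(A)$. Here $\mathrm{op}_\varepsilon(A)=(A^{-\varepsilon})^{\varepsilon}$ and $\mathrm{cl}_\varepsilon(A)=(A^{\varepsilon})^{-\varepsilon}$, where $S^{\varepsilon}=\{x:\operatorname{dist}(x,S)<\varepsilon\}$ and $S^{-\varepsilon}=\{x:\operatorname{dist}(x,S^c)\ge\varepsilon\}$, with $\operatorname{dist}(x,\emptyset)=\infty$. -/

import Mathlib

open scoped ENNReal NNReal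

noncomputable section

namespace AdversarialTraining

/-- The adversarial risk `𝔼_{(x,y)∼μ} [ sup_{x' ∈ B_ε(x)} |1_A(x') - y| ]` of the classifier
given by `A`, with labels `y ∈ {0, 1}` and open balls `B_ε(x)`. -/
def risk {X : Type*} [PseudoMetricSpace X] [MeasurableSpace X]
    (ε : ℝ) (μ : MeasureTheory.Measure (X × Fin 2)) (A : Set X) : ℝ≥0∞ :=
  ∫⁻ p, ⨆ x' ∈ Metric.ball p.1 ε,
    ENNReal.ofReal |A.indicator (fun _ => (1 : ℝ)) x' - ((p.2 : ℕ) : ℝ)| ∂μ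

/-- `A` is a solution of the adversarial problem: a measurable (Borel) set which minimizes the
adversarial risk among all such sets. -/
def IsMinimizer {X : Type*} [PseudoMetricSpace X] [MeasurableSpace X]
    (ε : ℝ) (μ : MeasureTheory.Measure (X × Fin 2)) (A : Set X) : Prop :=
  MeasurableSet A ∧ ∀ A' : Set X, MeasurableSet A' → risk ε μ A ≤ risk ε μ A'

/-- The dilation `A^ε = {x | dist(x, A) < ε}`, where `dist(x, ∅) = ∞`. -/
def dilation {X : Type*} [PseudoMetricSpace X] (ε : ℝ) (A : Set X) : Set X :=
  {x | Metric.infEDist x A < ENNReal.ofReal ε}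

/-- The erosion `A^{-ε} = {x | dist(x, Aᶜ) ≥ ε}`, where `dist(x, ∅) = ∞`. -/
def erosion {X : Type*} [PseudoMetricSpace X] (ε : ℝ) (A : Set X) : Set X :=
  {x | ENNReal.ofReal ε ≤ Metric.infEDist x Aᶜ}

/-- The closing `cl_ε(A) = (A^ε)^{-ε}`. -/
def closing {X : Type*} [PseudoMetricSpace X] (ε : ℝ) (A : Set X) : Set X :=
  erosion ε (dilation ε A)

/-- The opening `op_ε(A) = (A^{-ε})^ε`. -/
def opening {X : Type*} [PseudoMetricSpace X] (ε : ℝ) (A : Set X) : Set X :=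
  dilation ε (erosion ε A)

/-- The function `g` is of class `C^{1,α}` on the (open) set `V`: it is continuously
differentiable there and its derivative is Hölder continuous on `V` with exponent `α`. -/
def IsC1HolderOn {F : Type*} [NormedAddCommGroup F] [NormedSpace ℝ F]
    (α : ℝ≥0) (g : F → ℝ) (V : Set F) : Prop :=
  ContDiffOn ℝ 1 g V ∧ ∃ C : ℝ≥0, HolderOnWith C α (fderiv ℝ g) V

/-- The boundary of `B` is locally the graph of a `C^{1,α}` function: around every boundary point
there are a unit vector `n` and a `C^{1,α}` function `g` on an open subset `V` of the hyperplane
`n^⊥` such that, in an open neighbourhood `U` of the point, the boundary of `B` is the graph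
`{z + g(z) n}` of `g` over `n^⊥`, and `B` lies locally on one side of this graph. -/
def HasC1HolderBoundary {E : Type*} [NormedAddCommGroup E] [InnerProductSpace ℝ E]
    (α : ℝ≥0) (B : Set E) : Prop :=
  ∀ x ∈ frontier B, ∃ n : E, ‖n‖ = 1 ∧
    ∃ (g : (Submodule.span ℝ {n})ᗮ → ℝ) (V : Set (Submodule.span ℝ {n})ᗮ) (U : Set E),
      IsOpen V ∧ IsC1HolderOn α g V ∧ IsOpen U ∧ x ∈ U ∧
      ∀ y ∈ U, (Submodule.span ℝ {n})ᗮ.orthogonalProjectionOnto y ∈ V ∧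
        (y ∈ frontier B ↔ inner ℝ n y = g ((Submodule.span ℝ {n})ᗮ.orthogonalProjectionOnto y)) ∧
        (inner ℝ n y < g ((Submodule.span ℝ {n})ᗮ.orthogonalProjectionOnto y) → y ∈ B) ∧
        (g ((Submodule.span ℝ {n})ᗮ.orthogonalProjectionOnto y) < inner ℝ n y → y ∉ B)

end AdversarialTraining

end

/-!
The proof rests on a geometric description of the risk and on an interposition of a regular set
between two families of balls.

The risk of `A` is the measure of a set (`risk_eq_measure_errorSet`) made of the `ε`-thickening of
`A` on the label `0` and the `ε`-thickening of `Aᶜ` on the label `1`. Thickenings commute with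
unions, so the risk is submodular and lower semicontinuous along monotone sequences; the superior
limit of a fast minimizing sequence is then a minimizer (`exists_isMinimizer`). Closing `A` does
not change its thickening and opening `A` does not change the thickening of `Aᶜ`, so every
measurable set between the opening and the closing of a minimizer is a minimizer as well
(`IsMinimizer.of_opening_subset_of_subset_closing`).

The opening of `A` is the open `ε`-thickening of the closed set `S` of points at distance at least
`ε` from `Aᶜ`, and the complement of the closing is the open `ε`-thickening of the closed set `T`
of points at distance at least `ε` from `A`. Points `p ∈ S` and `q ∈ T` are at distance at least
`2ε`, which says precisely that `ε² - |x - p|² ≤ |x - q|² - ε²` for all `x`. Between these two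
families of paraboloids there is a `C^{1,1}` function `f`
(`exists_lipschitz_fderiv_between`): up to the summand `-|x|²` it is the convex envelope of the
infimum of the upper family. It is positive on the thickening of `S` and negative on that of `T`.

The zeros of `f` on the boundaries of the two thickenings are regular, because `f` touches a
paraboloid with nonvanishing gradient there (`fderiv_ne_zero_of_touching`). Outside of the
closures of the thickenings `f` may be changed freely, and adding a generic affine function,
multiplied by a smooth function supported there, makes all zeros regular
(`exists_perturbation_regular_zeros`). The positivity set of the resulting function has the desired
boundary by the implicit function theorem (`exists_implicit_C1Holder`). This boundary is even of
class `C^{1,1}`.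
-/

namespace AdversarialTraining

open MeasureTheory Metric Set Filter Topology
open scoped RealInnerProductSpace

/-! ### The risk as the measure of the misclassifiable set -/

section Risk

variable {X : Type*} [PseudoMetricSpace X]

/-- The labelled points which some perturbation of size less than `ε` leads to a
misclassification by `A`: those of label `0` in the `ε`-thickening of `A` and those of label `1`
in the `ε`-thickening of `Aᶜ`. -/
def errorSet (ε : ℝ) (A : Set X) : Set (X × Fin 2) :=
  {p | (p.2 = 0 ∧ p.1 ∈ thickening ε A) ∨ (p.2 = 1 ∧ p.1 ∈ thickening ε Aᶜ)}

theorem mem_errorSet {ε : ℝ} {A : Set X} {p : X × Fin 2} :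
    p ∈ errorSet ε A ↔
      (p.2 = 0 ∧ p.1 ∈ thickening ε A) ∨ (p.2 = 1 ∧ p.1 ∈ thickening ε Aᶜ) :=
  Iff.rfl

theorem errorSet_eq_union (ε : ℝ) (A : Set X) :
    errorSet ε A = thickening ε A ×ˢ {0} ∪ thickening ε Aᶜ ×ˢ {1} := by
  ext p
  simp [mem_errorSet, and_comm]

theorem measurableSet_errorSet [MeasurableSpace X] [OpensMeasurableSpace X] (ε : ℝ) (A : Set X) :
    MeasurableSet (errorSet ε A) := by
  rw [errorSet_eq_union]
  exact (isOpen_thickening.measurableSet.prod (measurableSet_singleton _)).union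
    (isOpen_thickening.measurableSet.prod (measurableSet_singleton _))

theorem iSup_ball_loss_eq_indicator (ε : ℝ) (A : Set X) (p : X × Fin 2) :
    (⨆ x' ∈ ball p.1 ε, ENNReal.ofReal |A.indicator (fun _ => (1 : ℝ)) x' - ((p.2 : ℕ) : ℝ)|) =
      (errorSet ε A).indicator 1 p := by
  have key : ∀ (S : Set X) (x : X) (l : X → ℝ≥0∞), (∀ y ∈ S, l y = 1) → (∀ y ∉ S, l y = 0) →
      (⨆ y ∈ ball x ε, l y) = (thickening ε S).indicator 1 x := by
    intro S x l h1 h0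
    by_cases hx : x ∈ thickening ε S
    · rw [indicator_of_mem hx]
      obtain ⟨z, hz, hd⟩ := mem_thickening_iff.1 hx
      refine le_antisymm (iSup₂_le fun y _ => ?_) ?_
      · by_cases hy : y ∈ S
        · exact (h1 y hy).le
        · simp [h0 y hy]
      · have := le_iSup₂ (f := fun y (_ : y ∈ ball x ε) => l y) z (by rwa [mem_ball, dist_comm])
        rwa [h1 z hz] at this
    · rw [indicator_of_notMem hx]
      refine le_antisymm (iSup₂_le fun y hy => ?_) (zero_le)
      have hyS : y ∉ S := fun h => hx (mem_thickening_iff.2 ⟨y, h, by rwa [dist_comm]⟩)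
      exact (h0 y hyS).le
  obtain ⟨x, i⟩ := p
  have hi : i = 0 ∨ i = 1 := by omega
  rcases hi with rfl | rfl
  · have := key A x (fun x' => ENNReal.ofReal |A.indicator (fun _ => (1 : ℝ)) x' - 0|)
      (fun y hy => by simp [hy]) (fun y hy => by simp [hy])
    have hm : (x, 0) ∈ errorSet ε A ↔ x ∈ thickening ε A := by simp [mem_errorSet]
    have he : (errorSet ε A).indicator (1 : X × Fin 2 → ℝ≥0∞) (x, 0) =
        (thickening ε A).indicator 1 x := by
      by_cases h : x ∈ thickening ε A
      · rw [indicator_of_mem h, indicator_of_mem (hm.2 h)]; rfl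
      · rw [indicator_of_notMem h, indicator_of_notMem (mt hm.1 h)]
    rw [he, ← this]
    simp
  · have := key Aᶜ x (fun x' => ENNReal.ofReal |A.indicator (fun _ => (1 : ℝ)) x' - 1|)
      (fun y hy => by rw [mem_compl_iff] at hy; simp [hy])
      (fun y hy => by rw [notMem_compl_iff] at hy; simp [hy])
    have hm : (x, 1) ∈ errorSet ε A ↔ x ∈ thickening ε Aᶜ := by simp [mem_errorSet]
    have he : (errorSet ε A).indicator (1 : X × Fin 2 → ℝ≥0∞) (x, 1) =
        (thickening ε Aᶜ).indicator 1 x := by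
      by_cases h : x ∈ thickening ε Aᶜ
      · rw [indicator_of_mem h, indicator_of_mem (hm.2 h)]; rfl
      · rw [indicator_of_notMem h, indicator_of_notMem (mt hm.1 h)]
    rw [he, ← this]
    simp

theorem opening_eq (ε : ℝ) (A : Set X) :
    opening ε A = thickening ε (thickening ε Aᶜ)ᶜ := by
  have : erosion ε A = (thickening ε Aᶜ)ᶜ := by
    ext x; simp [erosion, mem_thickening_iff_infEDist_lt]
  rw [opening, this]; rfl

theorem closing_eq (ε : ℝ) (A : Set X) :
    closing ε A = (thickening ε (thickening ε A)ᶜ)ᶜ := by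
  ext x; simp [closing, erosion, dilation, thickening]

variable [MeasurableSpace X] [OpensMeasurableSpace X]

theorem risk_eq_measure_errorSet (ε : ℝ) (μ : Measure (X × Fin 2)) (A : Set X) :
    risk ε μ A = μ (errorSet ε A) := by
  simp_rw [risk, iSup_ball_loss_eq_indicator]
  rw [lintegral_indicator_one (measurableSet_errorSet ε A)]

/-- The risk is submodular. -/
theorem risk_union_add_risk_inter_le (ε : ℝ) (μ : Measure (X × Fin 2)) (A B : Set X) :
    risk ε μ (A ∪ B) + risk ε μ (A ∩ B) ≤ risk ε μ A + risk ε μ B := by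
  simp only [risk_eq_measure_errorSet]
  rw [← measure_union_add_inter _ (measurableSet_errorSet ε (A ∩ B)),
    ← measure_union_add_inter _ (measurableSet_errorSet ε B)]
  have hAB : thickening ε (A ∩ B) ⊆ thickening ε A ∩ thickening ε B :=
    subset_inter (thickening_subset_of_subset _ inter_subset_left)
      (thickening_subset_of_subset _ inter_subset_right)
  have hAB' : thickening ε (Aᶜ ∩ Bᶜ) ⊆ thickening ε Aᶜ ∩ thickening ε Bᶜ :=
    subset_inter (thickening_subset_of_subset _ inter_subset_left)
      (thickening_subset_of_subset _ inter_subset_right)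
  refine add_le_add (measure_mono ?_) (measure_mono ?_) <;> rintro p hp <;>
    simp only [mem_union, mem_inter_iff, mem_errorSet, compl_union, compl_inter,
      thickening_union] at hp ⊢ <;>
    have h1 := @hAB p.1 <;> have h2 := @hAB' p.1 <;>
    simp only [mem_inter_iff] at h1 h2 <;>
    have h3 : ¬ (p.2 = 0 ∧ p.2 = 1) := by rintro ⟨h, h'⟩; rw [h] at h'; exact absurd h' (by decide)
  all_goals tauto

/-- Lower semicontinuity of the risk along sequences whose error sets eventually capture each
point of the error set of the limit. -/
theorem risk_le_of_eventually {ε : ℝ} {μ : Measure (X × Fin 2)} {A : Set X} {S : ℕ → Set X}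
    {c : ℝ≥0∞} (hS : ∀ p ∈ errorSet ε A, ∀ᶠ k in atTop, p ∈ errorSet ε (S k))
    (hc : ∀ᶠ k in atTop, risk ε μ (S k) ≤ c) : risk ε μ A ≤ c := by
  obtain ⟨N, hN⟩ := eventually_atTop.1 hc
  have hsub : errorSet ε A ⊆ ⋃ m, ⋂ k ≥ m, errorSet ε (S k) := by
    intro p hp
    obtain ⟨m, hm⟩ := eventually_atTop.1 (hS p hp)
    exact mem_iUnion.2 ⟨m, mem_iInter₂.2 hm⟩
  have hmono : Monotone fun m => ⋂ k ≥ m, errorSet ε (S k) := fun m m' h =>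
    biInter_mono (fun k (hk : m' ≤ k) => h.trans hk) fun _ _ => subset_rfl
  rw [risk_eq_measure_errorSet]
  refine (measure_mono hsub).trans ?_
  rw [hmono.measure_iUnion]
  refine iSup_le fun m => ?_
  refine (measure_mono ?_).trans
    ((risk_eq_measure_errorSet ε μ _).symm.trans_le (hN (max m N) (le_max_right _ _)))
  exact biInter_subset_of_mem (le_max_left m N)

/-- The risk is lower semicontinuous along increasing unions. -/
theorem risk_iUnion_le {ε : ℝ} {μ : Measure (X × Fin 2)} {S : ℕ → Set X} (hS : Monotone S)
    {c : ℝ≥0∞} (hc : ∀ᶠ k in atTop, risk ε μ (S k) ≤ c) : risk ε μ (⋃ k, S k) ≤ c := by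
  refine risk_le_of_eventually (fun p hp => ?_) hc
  rcases hp with ⟨h0, hp⟩ | ⟨h1, hp⟩
  · rw [thickening_iUnion] at hp
    obtain ⟨m, hm⟩ := mem_iUnion.1 hp
    filter_upwards [eventually_ge_atTop m] with k hk
    exact Or.inl ⟨h0, thickening_subset_of_subset _ (hS hk) hm⟩
  · refine Eventually.of_forall fun k => Or.inr ⟨h1, ?_⟩
    exact thickening_subset_of_subset _ (compl_subset_compl.2 (subset_iUnion _ _)) hp

/-- The risk is lower semicontinuous along decreasing intersections. -/
theorem risk_iInter_le {ε : ℝ} {μ : Measure (X × Fin 2)} {S : ℕ → Set X} (hS : Antitone S)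
    {c : ℝ≥0∞} (hc : ∀ᶠ k in atTop, risk ε μ (S k) ≤ c) : risk ε μ (⋂ k, S k) ≤ c := by
  refine risk_le_of_eventually (fun p hp => ?_) hc
  rcases hp with ⟨h0, hp⟩ | ⟨h1, hp⟩
  · refine Eventually.of_forall fun k => Or.inl ⟨h0, ?_⟩
    exact thickening_subset_of_subset _ (iInter_subset _ _) hp
  · rw [compl_iInter, thickening_iUnion] at hp
    obtain ⟨m, hm⟩ := mem_iUnion.1 hp
    filter_upwards [eventually_ge_atTop m] with k hk
    exact Or.inr ⟨h1, thickening_subset_of_subset _ (compl_subset_compl.2 (hS hk)) hm⟩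

/-- By submodularity the excess risks of finitely many sets add up when their union is taken; by
lower semicontinuity the same holds for countable unions. -/
theorem risk_iUnion_le_add_tsum {ε : ℝ} {μ : Measure (X × Fin 2)} {I : ℝ≥0∞} (hI : I ≠ ∞)
    (hle : ∀ A, MeasurableSet A → I ≤ risk ε μ A) {S : ℕ → Set X} {δ : ℕ → ℝ≥0∞}
    (hm : ∀ k, MeasurableSet (S k)) (hS : ∀ k, risk ε μ (S k) ≤ I + δ k) :
    risk ε μ (⋃ k, S k) ≤ I + ∑' k, δ k := by
  have hacc : ∀ k, risk ε μ (accumulate S k) ≤ I + ∑ i ∈ Finset.range (k + 1), δ i := by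
    intro k
    induction k with
    | zero => simpa using hS 0
    | succ k ih =>
      rw [accumulate_succ, Finset.sum_range_succ]
      have h1 := risk_union_add_risk_inter_le ε μ (accumulate S k) (S (k + 1))
      have hmk : MeasurableSet (accumulate S k) :=
        MeasurableSet.biUnion (to_countable _) fun i _ => hm i
      have h2 := hle _ (hmk.inter (hm (k + 1)))
      refine (ENNReal.add_le_add_iff_right hI).1 ?_
      calc risk ε μ (accumulate S k ∪ S (k + 1)) + I
          ≤ _ := (add_le_add_right h2 _).trans h1
        _ ≤ _ := add_le_add ih (hS (k + 1))
        _ = _ := by ring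
  rw [← iUnion_accumulate]
  refine risk_iUnion_le monotone_accumulate (Eventually.of_forall fun k => (hacc k).trans ?_)
  gcongr
  exact ENNReal.sum_le_tsum _

/-- A minimizer is the superior limit of a minimizing sequence whose excess risks are summable. -/
theorem exists_isMinimizer (ε : ℝ) (μ : Measure (X × Fin 2)) [IsFiniteMeasure μ] :
    ∃ A : Set X, IsMinimizer ε μ A := by
  set I : ℝ≥0∞ := ⨅ A : {A : Set X // MeasurableSet A}, risk ε μ A with hIdef
  have hle : ∀ A, MeasurableSet A → I ≤ risk ε μ A := fun A hA =>
    iInf_le (fun A : {A : Set X // MeasurableSet A} => risk ε μ A) ⟨A, hA⟩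
  have hI : I ≠ ∞ := by
    refine ne_top_of_le_ne_top ?_ (hle ∅ MeasurableSet.empty)
    rw [risk_eq_measure_errorSet]
    exact measure_ne_top _ _
  obtain ⟨δ, hδ0, hδ⟩ := ENNReal.exists_pos_sum_of_countable' (ε := 1) one_ne_zero ℕ
  have hex : ∀ n, ∃ A, MeasurableSet A ∧ risk ε μ A ≤ I + δ n := by
    intro n
    obtain ⟨A, hA⟩ := iInf_lt_iff.1 (ENNReal.lt_add_right hI (hδ0 n).ne')
    exact ⟨A, A.2, hA.le⟩
  choose S hSm hS using hex
  refine ⟨⋂ m, ⋃ k, S (k + m),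
    MeasurableSet.iInter fun m => MeasurableSet.iUnion fun k => hSm _, fun A' hA' => ?_⟩
  refine le_trans ?_ (hle A' hA')
  have hanti : Antitone fun m => ⋃ k, S (k + m) := by
    intro m m' h
    refine iUnion_subset fun k => ?_
    have : k + m' = (k + (m' - m)) + m := by omega
    rw [this]
    exact subset_iUnion (fun k => S (k + m)) _
  have hB : ∀ m, risk ε μ (⋃ k, S (k + m)) ≤ I + ∑' k, δ (k + m) := fun m =>
    risk_iUnion_le_add_tsum hI hle (fun k => hSm _) fun k => hS _
  have hlim := ENNReal.tendsto_sum_nat_add δ (hδ.trans ENNReal.one_lt_top).ne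
  refine ENNReal.le_of_forall_pos_le_add fun e he _ => ?_
  refine risk_iInter_le hanti ?_
  filter_upwards [(tendsto_order.1 hlim).2 e (by exact_mod_cast he)] with m hm
  exact (hB m).trans (by gcongr)

/-- Every measurable set between the opening and the closing of a minimizer is a minimizer: its
thickening is contained in that of the closing, which is the thickening of the minimizer, and
likewise for the complements. -/
theorem IsMinimizer.of_opening_subset_of_subset_closing {ε : ℝ} {μ : Measure (X × Fin 2)}
    {A B : Set X} (hA : IsMinimizer ε μ A) (hB : MeasurableSet B) (h1 : opening ε A ⊆ B)
    (h2 : B ⊆ closing ε A) : IsMinimizer ε μ B := by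
  refine ⟨hB, fun A' hA' => le_trans ?_ (hA.2 A' hA')⟩
  rw [opening_eq] at h1
  rw [closing_eq] at h2
  have key : ∀ S T : Set X, T ⊆ (thickening ε (thickening ε S)ᶜ)ᶜ →
      thickening ε T ⊆ thickening ε S := by
    intro S T h x hx
    by_contra hxS
    obtain ⟨z, hz, hd⟩ := mem_thickening_iff.1 hx
    exact h hz (mem_thickening_iff.2 ⟨x, hxS, by rwa [dist_comm]⟩)
  have k1 := key A B h2
  have k2 := key Aᶜ Bᶜ (compl_subset_compl.2 h1)
  rw [risk_eq_measure_errorSet, risk_eq_measure_errorSet]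
  refine measure_mono ?_
  rintro p (⟨h0, hp⟩ | ⟨h0, hp⟩)
  · exact Or.inl ⟨h0, k1 hp⟩
  · exact Or.inr ⟨h0, k2 hp⟩

end Risk

/-! ### A `C^{1,1}` function between two families of paraboloids -/

section Interposition

variable {E : Type*} [NormedAddCommGroup E] [InnerProductSpace ℝ E]

theorem hasFDerivAt_of_quadratic_bounds {ψ : E → ℝ} {x p : E} {C : ℝ}
    (h0 : ∀ y, 0 ≤ ψ y - ψ x - ⟪p, y - x⟫) (h1 : ∀ y, ψ y - ψ x - ⟪p, y - x⟫ ≤ C * ‖y - x‖ ^ 2) :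
    HasFDerivAt ψ (innerSL ℝ p) x := by
  rw [hasFDerivAt_iff_isLittleO]
  have h2 : (fun y => ‖y - x‖ ^ 2) =o[𝓝 x] fun y => y - x := by
    have := (Asymptotics.isLittleO_norm_pow_id (E' := E) one_lt_two).comp_tendsto
      (show Tendsto (fun y => y - x) (𝓝 x) (𝓝 0) by
        simpa using (continuous_sub_right x).tendsto x)
    exact this
  refine Asymptotics.IsBigO.trans_isLittleO (Asymptotics.IsBigO.of_bound C ?_) h2
  refine Eventually.of_forall fun y => ?_
  simp only [innerSL_apply_apply]
  rw [Real.norm_of_nonneg (h0 y), Real.norm_of_nonneg (by positivity)]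
  exact h1 y

/-- If a function lies at every point between its supporting affine function and a paraboloid of
opening `C` on top of that, its gradient is Lipschitz. -/
theorem lipschitzWith_of_quadratic_bounds {ψ : E → ℝ} {p : E → E} {C : ℝ≥0} (hC : 0 < C)
    (h0 : ∀ x y, 0 ≤ ψ y - ψ x - ⟪p x, y - x⟫)
    (h1 : ∀ x y, ψ y - ψ x - ⟪p x, y - x⟫ ≤ C * ‖y - x‖ ^ 2) :
    LipschitzWith (2 * C) p := by
  refine LipschitzWith.of_dist_le_mul fun x y => ?_
  have hC' : (0 : ℝ) < C := hC
  -- comparing the bounds based at `x` and at `y` in the point `y + k` controls `⟪p x - p y, k⟫`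
  set k : E := (2 * C : ℝ)⁻¹ • (p x - p y) with hk
  have a := h0 x (y + k)
  have b := h1 y (y + k)
  have c := h1 x y
  have e1 : ⟪p x, y + k - x⟫ = ⟪p x, y - x⟫ + ⟪p x, k⟫ := by
    rw [← inner_add_right]; congr 1; abel
  rw [add_sub_cancel_left] at b
  have e2 : ⟪p x, k⟫ - ⟪p y, k⟫ = (2 * C : ℝ)⁻¹ * ‖p x - p y‖ ^ 2 := by
    rw [← inner_sub_left, hk, real_inner_smul_right, real_inner_self_eq_norm_sq]
  have e3 : ‖k‖ ^ 2 = ((2 * C : ℝ)⁻¹) ^ 2 * ‖p x - p y‖ ^ 2 := by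
    rw [hk, norm_smul, mul_pow, Real.norm_of_nonneg (by positivity)]
  rw [e3] at b
  have e4 : (C : ℝ) * (((2 * C : ℝ)⁻¹) ^ 2 * ‖p x - p y‖ ^ 2) =
      (2 * C : ℝ)⁻¹ * ‖p x - p y‖ ^ 2 / 2 := by field_simp
  have h : (2 * C : ℝ)⁻¹ * ‖p x - p y‖ ^ 2 / 2 ≤ C * ‖y - x‖ ^ 2 := by linarith
  have h' : ‖p x - p y‖ ^ 2 ≤ (2 * C * ‖y - x‖) ^ 2 := by
    have : ‖p x - p y‖ ^ 2 = (4 * C) * ((2 * C : ℝ)⁻¹ * ‖p x - p y‖ ^ 2 / 2) := by field_simp; ring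
    rw [this]
    calc _ ≤ 4 * C * (C * ‖y - x‖ ^ 2) := by gcongr
      _ = _ := by ring
  rw [dist_eq_norm, dist_comm, dist_eq_norm]
  push_cast
  exact le_of_sq_le_sq h' (by positivity)

/-- The pairs `(a, p)` for which the affine function `a + ⟪p, ·⟫` is bounded above by all the
functions `‖· - q‖ ^ 2 + ‖·‖ ^ 2 - r` with `q ∈ T`. -/
def affineMinorants (T : Set E) (r : ℝ) : Set (ℝ × E) :=
  {s | ∀ y, ∀ q ∈ T, s.1 + ⟪s.2, y⟫ ≤ ‖y - q‖ ^ 2 + ‖y‖ ^ 2 - r}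

theorem isClosed_affineMinorants (T : Set E) (r : ℝ) : IsClosed (affineMinorants T r) := by
  simp only [affineMinorants, ofPred_forall]
  refine isClosed_iInter fun y => isClosed_biInter fun q _ => ?_
  exact isClosed_le (by fun_prop) (by fun_prop)

/-- At every point the supremum of the affine minorants is attained. -/
theorem exists_maximal_affineMinorant [FiniteDimensional ℝ E] {T : Set E} (hT : T.Nonempty)
    {r : ℝ} (hne : (affineMinorants T r).Nonempty) (x : E) :
    ∃ s ∈ affineMinorants T r, ∀ s' ∈ affineMinorants T r, s'.1 + ⟪s'.2, x⟫ ≤ s.1 + ⟪s.2, x⟫ := by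
  obtain ⟨s₀, hs₀⟩ := hne
  obtain ⟨q, hq⟩ := hT
  set c := s₀.1 + ⟪s₀.2, x⟫
  set K := affineMinorants T r ∩ {s | c ≤ s.1 + ⟪s.2, x⟫} with hK
  have hKcl : IsClosed K :=
    (isClosed_affineMinorants T r).inter (isClosed_le (by fun_prop) (by fun_prop))
  have hKbd : Bornology.IsBounded K := by
    set R := 16 * (2 * ‖x - q‖ ^ 2 + 2 * ‖x‖ ^ 2 - r - c) with hR
    have hp : ∀ s ∈ K, ‖s.2‖ ≤ R + 1 := by
      rintro ⟨a, p⟩ ⟨hs, hsc⟩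
      -- moving from `x` in direction `p / 8`, the affine function gains `‖p‖ ^ 2 / 8`, while its
      -- upper bound gains at most `‖p‖ ^ 2 / 16` over a constant
      have h1 := hs (x + (8⁻¹ : ℝ) • p) q hq
      simp only [mem_ofPred_eq] at hsc
      have e1 : ⟪p, x + (8⁻¹ : ℝ) • p⟫ = ⟪p, x⟫ + 8⁻¹ * ‖p‖ ^ 2 := by
        rw [inner_add_right, real_inner_smul_right, real_inner_self_eq_norm_sq]
      have e2 : ∀ u : E, ‖u + (8⁻¹ : ℝ) • p‖ ^ 2 ≤ 2 * ‖u‖ ^ 2 + ‖p‖ ^ 2 / 32 := by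
        intro u
        have h := norm_add_le u ((8⁻¹ : ℝ) • p)
        rw [norm_smul, Real.norm_of_nonneg (by norm_num)] at h
        have h' := pow_le_pow_left₀ (norm_nonneg _) h 2
        nlinarith [sq_nonneg (‖u‖ - 8⁻¹ * ‖p‖)]
      have e3 : x + (8⁻¹ : ℝ) • p - q = (x - q) + (8⁻¹ : ℝ) • p := by abel
      have h2 := e2 (x - q)
      have h3 := e2 x
      simp only [e1, e3] at h1
      have h4 : ‖p‖ ^ 2 ≤ R := by rw [hR]; linarith
      simp only
      nlinarith [sq_nonneg (‖p‖ - 1)]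
    refine (isBounded_iff_forall_norm_le.2
      ⟨max (max (‖q‖ ^ 2 - r) (-(c - (R + 1) * ‖x‖))) (R + 1), fun s hs => ?_⟩)
    rw [Prod.norm_def]
    refine max_le_max (abs_le'.2 ⟨le_max_of_le_left ?_, le_max_of_le_right ?_⟩) (hp s hs)
    · have := hs.1 0 q hq
      simpa using this
    · have h1 : c ≤ s.1 + ⟪s.2, x⟫ := hs.2
      have h2 := real_inner_le_norm s.2 x
      have h3 := mul_le_mul_of_nonneg_right (hp s hs) (norm_nonneg x)
      linarith
  have hKc : IsCompact K := isCompact_of_isClosed_isBounded hKcl hKbd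
  obtain ⟨s, hs, hmax⟩ := hKc.exists_isMaxOn (f := fun s => s.1 + ⟪s.2, x⟫) ⟨s₀, hs₀, le_refl c⟩
    (by fun_prop)
  refine ⟨s, hs.1, fun s' hs' => ?_⟩
  by_cases h : c ≤ s'.1 + ⟪s'.2, x⟫
  · exact hmax (show s' ∈ K from ⟨hs', h⟩)
  · exact (not_le.1 h).le.trans hs.2

/-- **Interposition.** Between a supremum of paraboloids opening downwards and an infimum of
paraboloids opening upwards there is a function with Lipschitz derivative. The function is
`ψ - ‖·‖ ^ 2`, where `ψ` is the convex envelope of `inf_q ‖· - q‖ ^ 2 + ‖·‖ ^ 2 - ε ^ 2`: a convex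
function that inherits from this infimum the upper bound on its second differences. -/
theorem exists_lipschitz_fderiv_between [FiniteDimensional ℝ E] {S T : Set E} (hS : S.Nonempty)
    (hT : T.Nonempty) {ε : ℝ} (hε : 0 < ε) (hST : ∀ p ∈ S, ∀ q ∈ T, 2 * ε ≤ ‖p - q‖) :
    ∃ (f : E → ℝ) (f' : E → E →L[ℝ] ℝ), (∀ x, HasFDerivAt f (f' x) x) ∧ LocallyLipschitz f' ∧
      (∀ p ∈ S, ∀ x, ε ^ 2 - ‖x - p‖ ^ 2 ≤ f x) ∧ ∀ q ∈ T, ∀ x, f x ≤ ‖x - q‖ ^ 2 - ε ^ 2 := by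
  have hmem : ∀ p ∈ S, (ε ^ 2 - ‖p‖ ^ 2, (2 : ℝ) • p) ∈ affineMinorants T (ε ^ 2) := by
    intro p hp y q hq
    have h1 := norm_sub_le_norm_sub_add_norm_sub p y q
    have h2 := hST p hp q hq
    have h3 : ‖p - y‖ ^ 2 = ‖p‖ ^ 2 - 2 * ⟪p, y⟫ + ‖y‖ ^ 2 := norm_sub_sq_real p y
    simp only [real_inner_smul_left]
    nlinarith [sq_nonneg (‖p - y‖ - ‖y - q‖), norm_nonneg (p - y), norm_nonneg (y - q)]
  obtain ⟨p₀, hp₀⟩ := hS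
  choose s hs hmax using exists_maximal_affineMinorant hT ⟨_, hmem p₀ hp₀⟩
  set ψ : E → ℝ := fun x => (s x).1 + ⟪(s x).2, x⟫ with hψ
  have h0 : ∀ x y, 0 ≤ ψ y - ψ x - ⟪(s x).2, y - x⟫ := by
    intro x y
    have := hmax y (s x) (hs x)
    simp only [hψ, inner_sub_right]
    linarith
  -- averaging the best minorants at `x + h` and `x - h` gives a minorant that competes at `x`
  have h2 : ∀ x h, ψ (x + h) + ψ (x - h) ≤ 2 * ψ x + 4 * ‖h‖ ^ 2 := by
    intro x h
    set s₁ := s (x + h) with hs₁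
    set s₂ := s (x - h) with hs₂
    have hmid : ((s₁.1 + s₂.1) / 2 + (⟪s₁.2, h⟫ - ⟪s₂.2, h⟫) / 2 - 2 * ‖h‖ ^ 2,
        (2⁻¹ : ℝ) • (s₁.2 + s₂.2)) ∈ affineMinorants T (ε ^ 2) := by
      intro y q hq
      have a := hs (x + h) (y + h) q hq
      have b := hs (x - h) (y - h) q hq
      have e1 := parallelogram_law_with_norm ℝ (y - q) h
      have e2 := parallelogram_law_with_norm ℝ y h
      rw [← hs₁, inner_add_right] at a
      rw [← hs₂, inner_sub_right] at b
      simp only [real_inner_smul_left, inner_add_left]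
      rw [show y + h - q = y - q + h by abel] at a
      rw [show y - h - q = y - q - h by abel] at b
      nlinarith
    have := hmax x _ hmid
    simp only [real_inner_smul_left, inner_add_left] at this
    simp only [hψ, ← hs₁, ← hs₂, inner_add_right, inner_sub_right]
    linarith
  have h1 : ∀ x y, ψ y - ψ x - ⟪(s x).2, y - x⟫ ≤ (4 : ℝ≥0) * ‖y - x‖ ^ 2 := by
    intro x y
    have a := h2 x (y - x)
    have b := h0 x (x - (y - x))
    rw [add_sub_cancel] at a
    rw [show x - (y - x) - x = -(y - x) by abel, inner_neg_right] at b
    push_cast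
    linarith
  have hlip := lipschitzWith_of_quadratic_bounds (by norm_num) h0 h1
  refine ⟨fun x => ψ x - ‖x‖ ^ 2, fun x => innerSL ℝ (s x).2 - (2 : ℝ) • innerSL ℝ x,
    fun x => ?_, ?_, fun p hp x => ?_, fun q hq x => ?_⟩
  · have hψx := hasFDerivAt_of_quadratic_bounds (h0 x) (h1 x)
    exact (hψx.sub (hasStrictFDerivAt_norm_sq x).hasFDerivAt).congr_fderiv (by ext; simp)
  · have l1 : LocallyLipschitz fun x => innerSL ℝ (s x).2 :=
      ((innerSL ℝ).lipschitz.comp hlip).locallyLipschitz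
    have l2 : LocallyLipschitz fun x : E => (2 : ℝ) • innerSL ℝ x :=
      ((2 : ℝ) • innerSL ℝ : E →L[ℝ] E →L[ℝ] ℝ).lipschitz.locallyLipschitz
    exact l1.sub l2
  · have h3 := hmax x _ (hmem p hp)
    have h4 : ‖x - p‖ ^ 2 = ‖x‖ ^ 2 - 2 * ⟪p, x⟫ + ‖p‖ ^ 2 := by
      rw [norm_sub_sq_real, real_inner_comm]
    simp only [real_inner_smul_left] at h3
    simp only [hψ]
    linarith
  · have := hs x x q hq
    simp only [hψ]
    linarith

end Interposition

/-! ### Generic perturbation to a regular zero set -/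

section Perturbation

theorem exists_lipschitzOnWith_comp {X Y Z : Type*} [PseudoMetricSpace X] [NormedAddCommGroup Y]
    [NormedSpace ℝ Y] [NormedAddCommGroup Z] [NormedSpace ℝ Z] {Γ : X → Y}
    (hΓ : LocallyLipschitz Γ) {Ψ : Y → Z} {x : X} (hΨ : ContDiffAt ℝ 1 Ψ (Γ x)) :
    ∃ K : ℝ≥0, ∃ t ∈ 𝓝 x, LipschitzOnWith K (fun y => Ψ (Γ y)) t := by
  obtain ⟨K, t, ht, hK⟩ := hΨ.exists_lipschitzOnWith
  obtain ⟨K', t', ht', hK'⟩ := hΓ x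
  refine ⟨K * K', t' ∩ Γ ⁻¹' t, inter_mem ht' (hΓ.continuous.continuousAt ht), ?_⟩
  exact hK.comp (hK'.mono inter_subset_left) fun y hy => hy.2

variable {E : Type*} [NormedAddCommGroup E] [NormedSpace ℝ E]

theorem locallyLipschitz_of_hasFDerivAt {f : E → ℝ} {f' : E → E →L[ℝ] ℝ}
    (hf : ∀ x, HasFDerivAt f (f' x) x) (hf' : Continuous f') : LocallyLipschitz f := by
  have h1 : ContDiff ℝ 1 f := by
    rw [contDiff_one_iff_fderiv]
    refine ⟨fun x => (hf x).differentiableAt, ?_⟩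
    rwa [show fderiv ℝ f = f' from funext fun x => (hf x).fderiv]
  exact fun x => h1.contDiffAt.exists_lipschitzOnWith

/-- The zeros of `f` outside of the open set `W` being regular, `f` can be changed in `W` so that
all zeros become regular. The change is `φ * (a + c)` for a linear functional `a` and a number
`c`, where `φ` is a smooth function with support `W`. A singular zero `x` of the sum determines
`(a, c)` as a locally Lipschitz function of `x`, so that for dimensional reasons almost no
`(a, c)` has singular zeros in `W`. No function more regular than `C^{1,1}` is needed, in contrast
to Sard's theorem. -/
theorem exists_perturbation_regular_zeros [FiniteDimensional ℝ E] {f : E → ℝ}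
    {f' : E → E →L[ℝ] ℝ} (hf : ∀ x, HasFDerivAt f (f' x) x) (hf' : LocallyLipschitz f')
    {W : Set E} (hW : IsOpen W) (hreg : ∀ x ∉ W, f x = 0 → f' x ≠ 0) :
    ∃ (F : E → ℝ) (F' : E → E →L[ℝ] ℝ), (∀ x, HasFDerivAt F (F' x) x) ∧ LocallyLipschitz F' ∧
      (∀ x ∉ W, F x = f x) ∧ ∀ x, F x = 0 → F' x ≠ 0 := by
  obtain ⟨φ, hφW, hφ, hφ01⟩ := hW.exists_contDiff_support_eq (n := 2)
  have hφ2 : ContDiff ℝ 2 φ := by exact_mod_cast hφ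
  have hdφ : ContDiff ℝ 1 (fderiv ℝ φ) := hφ2.fderiv_right (by norm_num)
  have hφd : ∀ x, HasFDerivAt φ (fderiv ℝ φ x) x := fun x =>
    (hφ2.differentiable (by norm_num) x).hasFDerivAt
  have hφ0 : ∀ x ∉ W, φ x = 0 := fun x hx => by
    rw [← hφW] at hx; exact Function.notMem_support.1 hx
  have hφne : ∀ x ∈ W, φ x ≠ 0 := fun x hx => by
    rw [← hφW] at hx; exact hx
  -- `φ` attains its minimum at its zeros
  have hdφ0 : ∀ x ∉ W, fderiv ℝ φ x = 0 := by
    intro x hx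
    refine IsLocalMin.fderiv_eq_zero (Eventually.of_forall fun y => ?_)
    rw [hφ0 x hx]
    exact (hφ01 (mem_range_self y)).1
  set Γ : E → E × ℝ × (E →L[ℝ] ℝ) := fun x => (x, f x, f' x) with hΓdef
  have hΓ : LocallyLipschitz Γ :=
    LocallyLipschitz.id.prodMk ((locallyLipschitz_of_hasFDerivAt hf hf'.continuous).prodMk hf')
  -- the functional and the constant for which a given point is a singular zero
  set α : E × ℝ × (E →L[ℝ] ℝ) → E →L[ℝ] ℝ := fun u =>
    (φ u.1)⁻¹ • ((u.2.1 * (φ u.1)⁻¹) • fderiv ℝ φ u.1 - u.2.2) with hα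
  set Ψ : E × ℝ × (E →L[ℝ] ℝ) → (E →L[ℝ] ℝ) × ℝ := fun u =>
    (α u, -(u.2.1 * (φ u.1)⁻¹) - α u u.1) with hΨdef
  have hΨ : ∀ x ∈ W, ContDiffAt ℝ 1 Ψ (Γ x) := by
    intro x hx
    have c1 : ContDiffAt ℝ 1 (fun u : E × ℝ × (E →L[ℝ] ℝ) => (φ u.1)⁻¹) (Γ x) := by
      refine ContDiffAt.inv ?_ (hφne x hx)
      exact ((hφ2.of_le (by norm_num)).comp contDiff_fst).contDiffAt
    have c2 : ContDiffAt ℝ 1 (fun u : E × ℝ × (E →L[ℝ] ℝ) => fderiv ℝ φ u.1) (Γ x) :=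
      (hdφ.comp contDiff_fst).contDiffAt
    have c3 : ContDiffAt ℝ 1 (fun u : E × ℝ × (E →L[ℝ] ℝ) => u.2.1) (Γ x) := by fun_prop
    have c4 : ContDiffAt ℝ 1 (fun u : E × ℝ × (E →L[ℝ] ℝ) => u.2.2) (Γ x) := by fun_prop
    have c5 : ContDiffAt ℝ 1 (fun u : E × ℝ × (E →L[ℝ] ℝ) => u.1) (Γ x) := by fun_prop
    have c6 : ContDiffAt ℝ 1 α (Γ x) := c1.smul (((c3.mul c1).smul c2).sub c4)
    exact c6.prodMk ((c3.mul c1).neg.sub (c6.clm_apply c5))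
  have hdim : dimH ((fun x => Ψ (Γ x)) '' W) < Module.finrank ℝ ((E →L[ℝ] ℝ) × ℝ) := by
    have h1 : dimH ((fun x => Ψ (Γ x)) '' W) ≤ dimH W :=
      dimH_image_le_of_locally_lipschitzOn fun x hx => by
        obtain ⟨K, t, ht, hK⟩ := exists_lipschitzOnWith_comp hΓ (hΨ x hx)
        exact ⟨K, t, mem_nhdsWithin_of_mem_nhds ht, hK⟩
    have h2 : dimH W ≤ Module.finrank ℝ E :=
      (dimH_mono (subset_univ W)).trans_eq (Real.dimH_univ_eq_finrank E)
    have h3 : Module.finrank ℝ (E →L[ℝ] ℝ) = Module.finrank ℝ E := by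
      rw [← Subspace.dual_finrank_eq (K := ℝ) (V := E)]
      exact (LinearMap.toContinuousLinearMap (𝕜 := ℝ) (E := E) (F' := ℝ)).symm.finrank_eq
    refine (h1.trans h2).trans_lt ?_
    rw [Module.finrank_prod, h3, Module.finrank_self]
    exact_mod_cast Nat.lt_succ_self _
  obtain ⟨⟨a, c⟩, hac⟩ := (dense_compl_of_dimH_lt_finrank hdim).nonempty
  refine ⟨fun x => f x + φ x * (a x + c),
    fun x => f' x + (φ x • a + (a x + c) • fderiv ℝ φ x), fun x => ?_, ?_, fun x hx => ?_,
    fun x hx0 hx0' => ?_⟩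
  · exact (hf x).add ((hφd x).mul (a.hasFDerivAt.add_const c))
  · have h1 : ContDiff ℝ 1 fun x => φ x • a + (a x + c) • fderiv ℝ φ x :=
      ((hφ2.of_le (by norm_num)).smul contDiff_const).add
        ((a.contDiff.add contDiff_const).smul hdφ)
    exact hf'.add fun x => h1.contDiffAt.exists_lipschitzOnWith
  · simp [hφ0 x hx]
  · by_cases hx : x ∈ W
    · refine hac ⟨x, hx, ?_⟩
      have hne := hφne x hx
      have e1 : a x + c = -(f x * (φ x)⁻¹) := by
        field_simp
        linarith
      have e2 : α (Γ x) = a := by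
        simp only [hα, hΓdef]
        rw [inv_smul_eq_iff₀ hne]
        simp only [e1] at hx0'
        rw [neg_smul] at hx0'
        rw [← sub_eq_zero, ← neg_eq_zero, ← hx0']
        abel
      simp only [hΨdef, e2]
      simp only [hΓdef, Prod.mk.injEq, true_and]
      linarith
    · simp only [hφ0 x hx, hdφ0 x hx, zero_mul, add_zero, zero_smul, smul_zero] at hx0 hx0'
      exact hreg x hx hx0 hx0'

end Perturbation

/-! ### Implicit functions of class `C^{1,1}` -/

section Implicit

variable {H : Type*} [NormedAddCommGroup H] [NormedSpace ℝ H]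

/-- Differentiability of an implicitly defined function that is known to be Lipschitz. -/
theorem hasFDerivAt_of_implicit {F : H × ℝ → ℝ} {L : H × ℝ →L[ℝ] ℝ} {g : H → ℝ} {z : H}
    (hF : HasFDerivAt F L (z, g z)) (hL : L (0, 1) ≠ 0)
    (hg : (fun w => g w - g z) =O[𝓝 z] fun w => w - z) (h0 : ∀ᶠ w in 𝓝 z, F (w, g w) = 0) :
    HasFDerivAt g (-(L (0, 1))⁻¹ • L.comp (ContinuousLinearMap.inl ℝ H ℝ)) z := by
  have hz : F (z, g z) = 0 := h0.self_of_nhds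
  have hw0 : (fun w => w - z) =O[𝓝 z] fun w => w - z := Asymptotics.isBigO_refl _ _
  have hcont : Tendsto (fun w => (w, g w)) (𝓝 z) (𝓝 (z, g z)) := by
    refine tendsto_id.prodMk_nhds ?_
    have : Tendsto (fun w => g w - g z) (𝓝 z) (𝓝 0) :=
      hg.trans_tendsto (by simpa using (continuous_sub_right z).tendsto z)
    simpa using this.add_const (g z)
  have h1 := (hasFDerivAt_iff_isLittleO.1 hF).comp_tendsto hcont
  have h2 : (fun w => (w, g w) - (z, g z)) =O[𝓝 z] fun w => w - z := hw0.prod_left hg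
  have h3 := h1.trans_isBigO h2
  rw [hasFDerivAt_iff_isLittleO]
  refine (h3.const_mul_left (-(L (0, 1))⁻¹)).congr' ?_ EventuallyEq.rfl
  filter_upwards [h0] with w hw
  simp only [Function.comp_apply, hw, hz]
  have e : L ((w, g w) - (z, g z)) = L (w - z, 0) + (g w - g z) * L (0, 1) := by
    have : ((w, g w) - (z, g z) : H × ℝ) = (w - z, 0) + (g w - g z) • (0, 1) := by simp
    rw [this, map_add, map_smul, smul_eq_mul]
  rw [e]
  simp only [FunLike.coe_smul, Pi.smul_apply, ContinuousLinearMap.comp_apply,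
    ContinuousLinearMap.inl_apply, smul_eq_mul]
  field_simp
  ring

/-- Implicit function theorem for functions with locally Lipschitz derivative: the zero set is
locally the graph of a function with Lipschitz derivative over a ball, hence of a
`C^{1,α}` function for every `α ≤ 1`, and the sign changes across this graph. -/
theorem exists_implicit_C1Holder {F : H × ℝ → ℝ} {F' : H × ℝ → H × ℝ →L[ℝ] ℝ}
    (hF : ∀ x, HasFDerivAt F (F' x) x) (hF' : LocallyLipschitz F') {z₀ : H} {t₀ : ℝ}
    (h0 : F (z₀, t₀) = 0) (h1 : F' (z₀, t₀) (0, 1) < 0) {α : ℝ≥0} (hα : α ≤ 1) :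
    ∃ (g : H → ℝ) (ρ r : ℝ), 0 < ρ ∧ 0 < r ∧ IsC1HolderOn α g (ball z₀ ρ) ∧
      ∀ z ∈ ball z₀ ρ, ∀ t ∈ Ioo (t₀ - r) (t₀ + r),
        (F (z, t) = 0 ↔ t = g z) ∧ (t < g z → 0 < F (z, t)) ∧ (g z < t → F (z, t) < 0) := by
  have hFc : Continuous F := continuous_iff_continuousAt.2 fun x => (hF x).continuousAt
  set x₀ : H × ℝ := (z₀, t₀)
  -- the derivative of the implicit function in terms of the derivative of `F`
  set Ψ : (H × ℝ →L[ℝ] ℝ) → (H →L[ℝ] ℝ) := fun L =>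
    -(L (0, 1))⁻¹ • L.comp (ContinuousLinearMap.inl ℝ H ℝ) with hΨdef
  have hΨ : ContDiffAt ℝ 1 Ψ (F' x₀) := by
    have c1 : ContDiffAt ℝ 1 (fun L : H × ℝ →L[ℝ] ℝ => L (0, 1)) (F' x₀) := by fun_prop
    have c2 : ContDiffAt ℝ 1
        (fun L : H × ℝ →L[ℝ] ℝ => L.comp (ContinuousLinearMap.inl ℝ H ℝ)) (F' x₀) :=
      contDiffAt_id.clm_comp contDiffAt_const
    exact (c1.inv h1.ne).neg.smul c2
  obtain ⟨K, N, hN, hK⟩ := exists_lipschitzOnWith_comp hF' hΨ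
  set m : ℝ := -(F' x₀ (0, 1)) / 2 with hm
  have hm0 : 0 < m := by rw [hm]; linarith
  set M : ℝ := ‖F' x₀‖ + 1
  have hM0 : 0 < M := by positivity
  have hev : ∀ᶠ x in 𝓝 x₀, x ∈ N ∧ F' x (0, 1) < -m ∧ ‖F' x‖ < M := by
    refine (Filter.Eventually.and (show ∀ᶠ x in 𝓝 x₀, x ∈ N from hN)) (Eventually.and ?_ ?_)
    · have hc : Continuous fun x => F' x (0, 1) := hF'.continuous.clm_apply continuous_const
      exact hc.continuousAt.eventually_lt continuousAt_const (by rw [hm]; linarith)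
    · exact hF'.continuous.norm.continuousAt.eventually_lt continuousAt_const (lt_add_one _)
  obtain ⟨r, hr, hball⟩ := nhds_basis_closedBall.eventually_iff.1 hev
  have hbox : ∀ z ∈ closedBall z₀ r, ∀ t ∈ Icc (t₀ - r) (t₀ + r), (z, t) ∈ closedBall x₀ r := by
    intro z hz t ht
    rw [← Real.closedBall_eq_Icc] at ht
    rw [← closedBall_prod_same]
    exact ⟨hz, ht⟩
  -- `F` decreases along the last coordinate at a rate of at least `m`
  have hdec : ∀ z ∈ closedBall z₀ r, ∀ s ∈ Icc (t₀ - r) (t₀ + r), ∀ t ∈ Icc (t₀ - r) (t₀ + r),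
      s ≤ t → F (z, t) - F (z, s) ≤ -m * (t - s) := by
    intro z hz s hs t ht hst
    have hd : ∀ u, HasDerivAt (fun u => F (z, u)) (F' (z, u) (0, 1)) u := by
      intro u
      have := (hF (z, u)).comp_hasDerivAt u ((hasDerivAt_const u z).prodMk (hasDerivAt_id u))
      exact this
    refine (convex_Icc (t₀ - r) (t₀ + r)).image_sub_le_mul_sub_of_deriv_le
      (f := fun u => F (z, u)) (fun u _ => (hd u).continuousAt.continuousWithinAt)
      (fun u _ => (hd u).differentiableAt.differentiableWithinAt) (fun u hu => ?_) s hs t ht hst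
    rw [(hd u).deriv]
    exact (hball (hbox z hz u (interior_subset hu))).2.1.le
  have hz₀ : z₀ ∈ closedBall z₀ r := mem_closedBall_self hr.le
  have hlo : t₀ - r ∈ Icc (t₀ - r) (t₀ + r) := ⟨le_rfl, by linarith⟩
  have hhi : t₀ + r ∈ Icc (t₀ - r) (t₀ + r) := ⟨by linarith, le_rfl⟩
  have hmid : t₀ ∈ Icc (t₀ - r) (t₀ + r) := ⟨by linarith, by linarith⟩
  have hev2 : ∀ᶠ z in 𝓝 z₀, 0 < F (z, t₀ - r) ∧ F (z, t₀ + r) < 0 := by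
    have a := hdec z₀ hz₀ _ hlo _ hmid (by linarith)
    have b := hdec z₀ hz₀ _ hmid _ hhi (by linarith)
    rw [h0] at a b
    have := mul_pos hm0 hr
    have hcont : ∀ t, ContinuousAt (fun z => F (z, t)) z₀ := fun t =>
      (hFc.comp (Continuous.prodMk_left t)).continuousAt
    exact (continuousAt_const.eventually_lt (hcont _) (by linarith)).and
      ((hcont _).eventually_lt continuousAt_const (by linarith))
  obtain ⟨ρ', hρ', hsign⟩ := nhds_basis_ball.eventually_iff.1 hev2
  set ρ := min ρ' r
  have hρ : 0 < ρ := lt_min hρ' hr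
  have hsub : ∀ z ∈ ball z₀ ρ, z ∈ closedBall z₀ r := fun z hz =>
    ball_subset_closedBall (ball_subset_ball (min_le_right _ _) hz)
  have hex : ∀ z, ∃ t, z ∈ ball z₀ ρ → t ∈ Icc (t₀ - r) (t₀ + r) ∧ F (z, t) = 0 := by
    intro z
    by_cases hz : z ∈ ball z₀ ρ
    · obtain ⟨a, b⟩ := hsign (ball_subset_ball (min_le_left _ _) hz)
      obtain ⟨t, ht, hFt⟩ := intermediate_value_Icc' (f := fun t => F (z, t))
        (show t₀ - r ≤ t₀ + r by linarith) (by fun_prop) ⟨b.le, a.le⟩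
      exact ⟨t, fun _ => ⟨ht, hFt⟩⟩
    · exact ⟨0, fun h => absurd h hz⟩
  choose g hg using hex
  have hneg : ∀ z ∈ ball z₀ ρ, ∀ t ∈ Icc (t₀ - r) (t₀ + r), g z < t → F (z, t) < 0 := by
    intro z hz t ht h
    have a := hdec z (hsub z hz) _ (hg z hz).1 t ht h.le
    rw [(hg z hz).2] at a
    have := mul_pos hm0 (sub_pos.2 h)
    linarith
  have hpos : ∀ z ∈ ball z₀ ρ, ∀ t ∈ Icc (t₀ - r) (t₀ + r), t < g z → 0 < F (z, t) := by
    intro z hz t ht h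
    have a := hdec z (hsub z hz) t ht _ (hg z hz).1 h.le
    rw [(hg z hz).2] at a
    have := mul_pos hm0 (sub_pos.2 h)
    linarith
  have hglip : ∀ z ∈ ball z₀ ρ, ∀ w ∈ ball z₀ ρ, g z ≤ g w → g w - g z ≤ M / m * ‖w - z‖ := by
    intro z hz w hw h
    have a := hdec z (hsub z hz) _ (hg z hz).1 _ (hg w hw).1 h
    have b := (convex_closedBall x₀ r).norm_image_sub_le_of_norm_hasFDerivWithin_le
      (fun x _ => (hF x).hasFDerivWithinAt) (fun x hx => (hball hx).2.2.le)
      (hbox z (hsub z hz) _ (hg w hw).1) (hbox w (hsub w hw) _ (hg w hw).1)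
    have e : ‖((w, g w) : H × ℝ) - (z, g w)‖ = ‖w - z‖ := by simp [Prod.norm_def]
    rw [(hg z hz).2] at a
    rw [(hg w hw).2, e, zero_sub, norm_neg, Real.norm_eq_abs] at b
    have c := (abs_le.1 b).1
    rw [div_mul_eq_mul_div, le_div_iff₀ hm0]
    linarith
  have hgder : ∀ z ∈ ball z₀ ρ, HasFDerivAt g (Ψ (F' (z, g z))) z := by
    intro z hz
    refine hasFDerivAt_of_implicit (hF _) ?_ ?_ ?_
    · have := (hball (hbox z (hsub z hz) _ (hg z hz).1)).2.1
      linarith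
    · refine Asymptotics.IsBigO.of_bound (M / m) ?_
      filter_upwards [isOpen_ball.mem_nhds hz] with w hw
      rw [Real.norm_eq_abs]
      rcases le_total (g z) (g w) with h | h
      · rw [abs_of_nonneg (sub_nonneg.2 h)]
        exact hglip z hz w hw h
      · rw [abs_sub_comm, abs_of_nonneg (sub_nonneg.2 h), norm_sub_rev]
        exact hglip w hw z hz h
    · filter_upwards [isOpen_ball.mem_nhds hz] with w hw
      exact (hg w hw).2
  have hgL : LipschitzOnWith (M / m).toNNReal g (ball z₀ ρ) := by
    refine LipschitzOnWith.of_dist_le_mul fun z hz w hw => ?_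
    rw [Real.coe_toNNReal _ (by positivity), Real.dist_eq, dist_eq_norm]
    rcases le_total (g z) (g w) with h | h
    · rw [abs_sub_comm, abs_of_nonneg (sub_nonneg.2 h), norm_sub_rev]
      exact hglip z hz w hw h
    · rw [abs_of_nonneg (sub_nonneg.2 h)]
      exact hglip w hw z hz h
  have hgrL : LipschitzOnWith (max 1 (M / m).toNNReal) (fun z => (z, g z)) (ball z₀ ρ) :=
    LipschitzWith.id.lipschitzOnWith.prodMk hgL
  have hderL : LipschitzOnWith (K * max 1 (M / m).toNNReal) (fderiv ℝ g) (ball z₀ ρ) := by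
    intro z hz w hw
    rw [(hgder z hz).fderiv, (hgder w hw).fderiv]
    exact hK.comp hgrL (fun z hz => (hball (hbox z (hsub z hz) _ (hg z hz).1)).1) hz hw
  refine ⟨g, ρ, r, hρ, hr, ⟨?_, ?_⟩, fun z hz t ht => ?_⟩
  · rw [show (1 : WithTop ℕ∞) = 0 + 1 from rfl, contDiffOn_succ_iff_fderiv_of_isOpen isOpen_ball]
    exact ⟨fun z hz => (hgder z hz).differentiableAt.differentiableWithinAt, by simp,
      contDiffOn_zero.2 hderL.continuousOn⟩
  · have h := (holderOnWith_one.2 hderL).of_le (D := (2 * ρ).toNNReal) (s := α) ?_ hα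
    · exact ⟨_, h⟩
    · intro x hx y hy
      rw [edist_dist]
      refine ENNReal.ofReal_le_ofReal ?_
      have := dist_triangle_right x y z₀
      rw [mem_ball] at hx hy
      linarith
  · have ht' := Ioo_subset_Icc_self ht
    refine ⟨⟨fun h => ?_, fun h => ?_⟩, hpos z hz t ht', hneg z hz t ht'⟩
    · rcases lt_trichotomy t (g z) with h' | h' | h'
      · exact absurd h (hpos z hz t ht' h').ne'
      · exact h'
      · exact absurd h (hneg z hz t ht' h').ne
    · rw [h]; exact (hg z hz).2

end Implicit

/-! ### Regular superlevel sets between the opening and the closing -/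

section Assembly

variable {E : Type*} [NormedAddCommGroup E] [InnerProductSpace ℝ E]

theorem frontier_pos_eq_of_regular_zeros {F : E → ℝ} {F' : E → E →L[ℝ] ℝ}
    (hF : ∀ x, HasFDerivAt F (F' x) x) (hreg : ∀ x, F x = 0 → F' x ≠ 0) :
    frontier {x | 0 < F x} = {x | F x = 0} := by
  have hFc : Continuous F := continuous_iff_continuousAt.2 fun x => (hF x).continuousAt
  refine Subset.antisymm (fun x hx => (frontier_lt_subset_eq continuous_const hFc hx).symm) ?_
  intro x (hx : F x = 0)
  rw [(isOpen_lt continuous_const hFc).frontier_eq]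
  refine ⟨?_, fun h => (show 0 < F x from h).ne' hx⟩
  -- otherwise `F ≤ 0` near `x`, so that `x` is a local maximum
  by_contra hcl
  have hmax : IsLocalMax F x := by
    filter_upwards [isClosed_closure.isOpen_compl.mem_nhds hcl] with y hy
    rw [hx]
    exact not_lt.1 fun h => hy (subset_closure h)
  exact hreg x hx (hmax.hasFDerivAt_eq_zero (hF x))

theorem hasC1HolderBoundary_of_regular_zeros [CompleteSpace E] {F : E → ℝ} {F' : E → E →L[ℝ] ℝ}
    (hF : ∀ x, HasFDerivAt F (F' x) x) (hF' : LocallyLipschitz F')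
    (hreg : ∀ x, F x = 0 → F' x ≠ 0) {α : ℝ≥0} (hα : α ≤ 1) :
    HasC1HolderBoundary α {x | 0 < F x} := by
  have hfr := frontier_pos_eq_of_regular_zeros hF hreg
  intro x₀ hx₀
  rw [hfr] at hx₀
  -- the outward normal is opposite to the gradient
  set v : E := (InnerProductSpace.toDual ℝ E).symm (F' x₀) with hv
  have hv0 : v ≠ 0 := fun h => hreg x₀ hx₀ (by simpa [hv] using h)
  have hvn : 0 < ‖v‖ := norm_pos_iff.2 hv0
  set n : E := -(‖v‖⁻¹ • v) with hn
  have hn1 : ‖n‖ = 1 := by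
    rw [hn, norm_neg, norm_smul, norm_inv, norm_norm, inv_mul_cancel₀ hvn.ne']
  have hF'n : F' x₀ n < 0 := by
    have : F' x₀ n = ⟪v, n⟫ := by rw [hv, InnerProductSpace.toDual_symm_apply]
    rw [this, hn, inner_neg_right, real_inner_smul_right, real_inner_self_eq_norm_sq]
    have : ‖v‖⁻¹ * ‖v‖ ^ 2 = ‖v‖ := by field_simp
    linarith
  set H := (Submodule.span ℝ {n})ᗮ
  set L : H × ℝ →L[ℝ] E := H.subtypeL.coprod (ContinuousLinearMap.toSpanSingleton ℝ n) with hL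
  have hLP : ∀ y, L (H.orthogonalProjectionOnto y, ⟪n, y⟫) = y := by
    intro y
    have h1 : (H.orthogonalProjectionOnto y : E) = y - ⟪n, y⟫ • n := by
      rw [Submodule.coe_orthogonalProjectionOnto_apply, Submodule.starProjection_orthogonal_val,
        Submodule.starProjection_unit_singleton ℝ hn1]
    simp [hL, h1]
  have hLip : LocallyLipschitz fun u => (F' (L u)).comp L :=
    ((ContinuousLinearMap.compL ℝ (H × ℝ) E ℝ).flip L).lipschitz.locallyLipschitz.comp
      (hF'.comp L.lipschitz.locallyLipschitz)
  obtain ⟨g, ρ, r, hρ, hr, hg, hgF⟩ := exists_implicit_C1Holder (F := fun u => F (L u))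
    (z₀ := H.orthogonalProjectionOnto x₀) (t₀ := ⟪n, x₀⟫)
    (fun u => (hF (L u)).comp u L.hasFDerivAt) hLip (by rw [hLP]; exact hx₀)
    (by rw [hLP]; simpa [hL] using hF'n) hα
  refine ⟨n, hn1, g, ball (H.orthogonalProjectionOnto x₀) ρ,
    H.orthogonalProjectionOnto ⁻¹' ball (H.orthogonalProjectionOnto x₀) ρ ∩
      (fun y => ⟪n, y⟫) ⁻¹' Ioo (⟪n, x₀⟫ - r) (⟪n, x₀⟫ + r), isOpen_ball, hg,
    (isOpen_ball.preimage (by fun_prop)).inter (isOpen_Ioo.preimage (by fun_prop)),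
    ⟨mem_ball_self hρ, by simpa using hr⟩, fun y hy => ⟨hy.1, ?_⟩⟩
  obtain ⟨h1, h2, h3⟩ := hgF _ hy.1 _ hy.2
  rw [hLP] at h1 h2 h3
  rw [hfr]
  exact ⟨h1, h2, fun h h' => (h3 h).not_gt h'⟩

/-- If `f` vanishes at `x` and lies above a paraboloid `ε ^ 2 - ‖· - p‖ ^ 2` that is nonnegative
at `x`, then the graph of `f` touches the paraboloid there, and they share a nonzero derivative. -/
theorem fderiv_ne_zero_of_touching {f : E → ℝ} {L : E →L[ℝ] ℝ} {x p : E} {ε : ℝ} (hε : 0 < ε)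
    (hf : HasFDerivAt f L x) (hx : f x = 0) (hxp : ‖x - p‖ ≤ ε)
    (hle : ∀ y, ε ^ 2 - ‖y - p‖ ^ 2 ≤ f y) : L ≠ 0 := by
  rintro rfl
  have hxp2 : ‖x - p‖ ^ 2 = ε ^ 2 := by
    have h1 := hle x
    have h2 := pow_le_pow_left₀ (norm_nonneg _) hxp 2
    linarith
  have hmin : IsLocalMin (fun y => f y + ‖y - p‖ ^ 2) x := by
    refine Eventually.of_forall fun y => ?_
    have h1 := hle y
    simp only [hx, hxp2]
    linarith
  have hd := hf.add (((hasFDerivAt_id x).sub_const p).norm_sq)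
  have h0 := congrArg (fun L : E →L[ℝ] ℝ => L (x - p)) (hmin.hasFDerivAt_eq_zero hd)
  simp at h0
  rw [← inner_sub_left, real_inner_self_eq_norm_sq, hxp2] at h0
  exact hε.ne' (pow_eq_zero_iff two_ne_zero |>.1 h0)

/-- Two closed sets with distance at least `2 * ε` have disjoint `ε`-thickenings, and these are
separated by an open set with `C^{1,α}` boundary. -/
theorem exists_C1Holder_separation [FiniteDimensional ℝ E] {S T : Set E} (hSc : IsClosed S)
    (hTc : IsClosed T) {ε : ℝ} (hε : 0 < ε) (hST : ∀ p ∈ S, ∀ q ∈ T, 2 * ε ≤ ‖p - q‖)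
    {α : ℝ≥0} (hα : α ≤ 1) :
    ∃ B : Set E, IsOpen B ∧ thickening ε S ⊆ B ∧ B ⊆ (thickening ε T)ᶜ ∧
      HasC1HolderBoundary α B := by
  rcases S.eq_empty_or_nonempty with rfl | hS
  · exact ⟨∅, isOpen_empty, by simp, by simp, by simp [HasC1HolderBoundary]⟩
  rcases T.eq_empty_or_nonempty with rfl | hT
  · exact ⟨univ, isOpen_univ, by simp, by simp, by simp [HasC1HolderBoundary]⟩
  have := FiniteDimensional.proper_real E
  have := FiniteDimensional.complete ℝ E
  obtain ⟨f, f', hf, hf', hfS, hfT⟩ := exists_lipschitz_fderiv_between hS hT hε hST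
  -- outside of `W` the zeros of `f` touch one of the paraboloids
  set W := (cthickening ε S ∪ cthickening ε T)ᶜ with hW
  have hWo : IsOpen W := (isClosed_cthickening.union isClosed_cthickening).isOpen_compl
  have hreg : ∀ x ∉ W, f x = 0 → f' x ≠ 0 := by
    intro x hx hx0
    rw [hW, notMem_compl_iff, hSc.cthickening_eq_biUnion_closedBall hε.le,
      hTc.cthickening_eq_biUnion_closedBall hε.le] at hx
    rcases hx with hx | hx
    · obtain ⟨p, hp, hxp⟩ := mem_iUnion₂.1 hx
      rw [mem_closedBall, dist_eq_norm] at hxp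
      exact fderiv_ne_zero_of_touching hε (hf x) hx0 hxp (hfS p hp)
    · obtain ⟨q, hq, hxq⟩ := mem_iUnion₂.1 hx
      rw [mem_closedBall, dist_eq_norm] at hxq
      refine neg_ne_zero.1
        (fderiv_ne_zero_of_touching hε (hf x).neg (by simp [hx0]) hxq fun y => ?_)
      have := hfT q hq y
      simp only [Pi.neg_apply]
      linarith
  obtain ⟨F, F', hF, hF', hFW, hFreg⟩ := exists_perturbation_regular_zeros hf hf' hWo hreg
  have hFc : Continuous F := continuous_iff_continuousAt.2 fun x => (hF x).continuousAt
  refine ⟨{x | 0 < F x}, isOpen_lt continuous_const hFc, fun x hx => ?_, fun x hx hxT => ?_,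
    hasC1HolderBoundary_of_regular_zeros hF hF' hFreg hα⟩
  · have hxW : x ∉ W := fun h => h (Or.inl (thickening_subset_cthickening _ _ hx))
    obtain ⟨p, hp, hxp⟩ := mem_thickening_iff.1 hx
    rw [dist_eq_norm] at hxp
    have := pow_lt_pow_left₀ hxp (norm_nonneg _) two_ne_zero
    rw [mem_ofPred_eq, hFW x hxW]
    linarith [hfS p hp x]
  · have hxW : x ∉ W := fun h => h (Or.inr (thickening_subset_cthickening _ _ hxT))
    obtain ⟨q, hq, hxq⟩ := mem_thickening_iff.1 hxT
    rw [dist_eq_norm] at hxq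
    have := pow_lt_pow_left₀ hxq (norm_nonneg _) two_ne_zero
    rw [mem_ofPred_eq, hFW x hxW] at hx
    linarith [hfT q hq x]

/-- A point of the erosion of `A` and a point of the erosion of `Aᶜ` have distance at least
`2 * ε`, since otherwise their midpoint would lie neither in `A` nor in `Aᶜ`. -/
theorem two_mul_le_norm_sub_of_mem_compl_thickening {A : Set E} {ε : ℝ} {p q : E}
    (hp : p ∈ (thickening ε Aᶜ)ᶜ) (hq : q ∈ (thickening ε A)ᶜ) : 2 * ε ≤ ‖p - q‖ := by
  by_contra! h
  have h1 : dist p (midpoint ℝ p q) < ε := by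
    rw [dist_left_midpoint, dist_eq_norm, Real.norm_eq_abs, abs_two]
    linarith
  have h2 : dist q (midpoint ℝ p q) < ε := by
    rw [dist_right_midpoint, dist_eq_norm, Real.norm_eq_abs, abs_two]
    linarith
  by_cases hA : midpoint ℝ p q ∈ A
  · exact hq (mem_thickening_iff.2 ⟨_, hA, h2⟩)
  · exact hp (mem_thickening_iff.2 ⟨_, hA, h1⟩)

theorem IsMinimizer.exists_C1Holder_isMinimizer [FiniteDimensional ℝ E] [MeasurableSpace E]
    [OpensMeasurableSpace E] {μ : Measure (E × Fin 2)} {ε : ℝ} (hε : 0 < ε) {A : Set E}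
    (hA : IsMinimizer ε μ A) {α : ℝ≥0} (hα : α ≤ 1) :
    ∃ B : Set E, opening ε A ⊆ B ∧ B ⊆ closing ε A ∧ IsMinimizer ε μ B ∧
      HasC1HolderBoundary α B := by
  obtain ⟨B, hBo, h1, h2, hB⟩ := exists_C1Holder_separation
    (S := (thickening ε Aᶜ)ᶜ) (T := (thickening ε A)ᶜ) isOpen_thickening.isClosed_compl
    isOpen_thickening.isClosed_compl hε
    (fun p hp q hq => two_mul_le_norm_sub_of_mem_compl_thickening hp hq) hα
  rw [← opening_eq] at h1
  rw [← closing_eq] at h2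
  exact ⟨B, h1, h2, hA.of_opening_subset_of_subset_closing hBo.measurableSet h1 h2, hB⟩

end Assembly

end AdversarialTraining

theorem mainTheorem11 (d : ℕ)
    (μ : MeasureTheory.Measure (EuclideanSpace ℝ (Fin d) × Fin 2))
    [MeasureTheory.IsProbabilityMeasure μ] (ε : ℝ) (hε : 0 < ε) :
    (∃ B : Set (EuclideanSpace ℝ (Fin d)),
      AdversarialTraining.IsMinimizer ε μ B ∧
      AdversarialTraining.HasC1HolderBoundary (1 / 3) B) ∧
    ∀ A : Set (EuclideanSpace ℝ (Fin d)), AdversarialTraining.IsMinimizer ε μ A →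
      ∃ B : Set (EuclideanSpace ℝ (Fin d)),
        AdversarialTraining.opening ε A ⊆ B ∧ B ⊆ AdversarialTraining.closing ε A ∧
        AdversarialTraining.IsMinimizer ε μ B ∧
        AdversarialTraining.HasC1HolderBoundary (1 / 3) B := by
  have hα : (1 / 3 : ℝ≥0) ≤ 1 := div_le_one_of_le₀ (by norm_num) (by norm_num)
  refine ⟨?_, fun A hA => hA.exists_C1Holder_isMinimizer hε hα⟩
  obtain ⟨A, hA⟩ := AdversarialTraining.exists_isMinimizer ε μ
  obtain ⟨B, -, -, hB, hB'⟩ := hA.exists_C1Holder_isMinimizer hε hα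
  exact ⟨B, hB, hB'⟩
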